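/- Let $M$ be a commutative monoid with group of invertible elements $M^\times$, and suppose that the quotient monoid $M/M^\times$ is finitely generated. Let $\mathscr{T}$ be the category of $M$-sets. A localising subcategory of $\mathscr{T}$ is a full subcategory, closed under isomorphisms in $\mathscr{T}$, whose inclusion functor has a left adjoint that respects finite limits; let $\mathfrak{Loc}(\mathscr{T})$ be the poset of all localising subcategories of $\mathscr{T}$, ordered by inclusion. Let $\mathrm{Spec}(M)$ be the set of prime ideals of $M$, i.e. of the subsets $\mathfrak{p}\subsetneq M$ (the empty set being allowed) such that $M\mathfrak{p}\subseteq\mathfrak{p}$ and such that $ab\in\mathfrak{p}$ implies $a\in\mathfrak{p}$ or $b\in\mathfrak{p}$, with the Zariski topology, whose closed sets are the sets $V(\mathfrak{a})=\{\mathfrak{p}\in\mathrm{Spec}(M) : \mathfrak{a}\subseteq\mathfrak{p}\}$ for ideals $\mathfrak{a}$ of $M$, i.e. (possibly empty) subsets $\mathfrak{a}\subseteq M$ with $M\mathfrak{a}\subseteq\mathfrak{a}$; let $\mathbf{Open}(\mathrm{Spec}(M))$ be the poset of its open subsets, ordered by inclusion. Then there is an isomorphism of posets $$\mathfrak{Loc}(\mathscr{T})\cong\mathbf{Open}(\mathrm{Spec}(M)).$$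 -/

import Mathlib

open CategoryTheory CategoryTheory.Limits

universe v u

/-- A prime ideal of a commutative monoid `M`: a proper ideal `I` (a subset with `M I ⊆ I`, the
empty subset being allowed) such that `a * b ∈ I` implies `a ∈ I` or `b ∈ I`. -/
@[ext]
structure MonoidSpec (M : Type u) [CommMonoid M] where
  /-- The underlying ideal. -/
  asIdeal : SemigroupIdeal M
  ne_univ : (asIdeal : Set M) ≠ Set.univ
  mem_or_mem : ∀ a b : M, a * b ∈ asIdeal → a ∈ asIdeal ∨ b ∈ asIdeal

namespace MonoidSpec

variable {M : Type u} [CommMonoid M]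

/-- The set `V(I)` of prime ideals containing the ideal `I`. -/
def zeroLocus (I : SemigroupIdeal M) : Set (MonoidSpec M) :=
  {p | (I : Set M) ⊆ p.asIdeal}

/-- The Zariski topology on `Spec M`: the closed sets are exactly the sets `V(I)`, where `I` runs
through the ideals of `M`. -/
instance zariskiTopology : TopologicalSpace (MonoidSpec M) :=
  TopologicalSpace.ofClosed (Set.range (zeroLocus (M := M)))
    (by
      refine ⟨{ carrier := Set.univ, smul_mem' := fun _ _ _ => Set.mem_univ _ }, ?_⟩
      refine Set.eq_empty_of_forall_notMem fun p hp => p.ne_univ ?_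
      exact Set.univ_subset_iff.mp hp)
    (by
      intro A hA
      refine ⟨{ carrier := {x | ∃ I : SemigroupIdeal M, zeroLocus I ∈ A ∧ x ∈ I}
                smul_mem' := ?_ }, ?_⟩
      · rintro c x ⟨I, hI, hx⟩
        exact ⟨I, hI, I.smul_mem c hx⟩
      · ext p
        constructor
        · intro hp Z hZ
          obtain ⟨I, rfl⟩ := hA hZ
          exact fun x hx => hp ⟨I, hZ, hx⟩
        · rintro hp x ⟨I, hI, hx⟩
          exact hp _ hI hx)
    (by
      rintro _ ⟨I, rfl⟩ _ ⟨J, rfl⟩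
      refine ⟨{ carrier := {x | x ∈ I ∧ x ∈ J}
                smul_mem' := fun c x hx => ⟨I.smul_mem c hx.1, J.smul_mem c hx.2⟩ }, ?_⟩
      ext p
      constructor
      · intro hp
        by_contra h
        simp only [zeroLocus, Set.mem_union, Set.mem_ofPred_eq, not_or, Set.not_subset] at h
        obtain ⟨⟨a, ha, hap⟩, b, hb, hbp⟩ := h
        have hab : a * b ∈ p.asIdeal :=
          hp ⟨by simpa [mul_comm] using I.smul_mem b ha, J.smul_mem a hb⟩
        exact (p.mem_or_mem a b hab).elim hap hbp
      · rintro (hp | hp) x hx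
        · exact hp hx.1
        · exact hp hx.2)

end MonoidSpec

/-- A full subcategory of `C`, given by a class `P` of objects, is localising if it is closed under
isomorphisms in `C` and its inclusion functor has a left adjoint which respects finite limits. -/
structure IsLocalisingSubcategory {C : Type u} [Category.{v} C] (P : ObjectProperty C) : Prop where
  mem_of_iso : ∀ {X Y : C}, (X ≅ Y) → P X → P Y
  exists_localisation : ∃ ρ : C ⥤ P.FullSubcategory, Nonempty (ρ ⊣ P.ι) ∧ PreservesFiniteLimits ρ

/-- The poset of localising subcategories of `C`, ordered by inclusion of classes of objects. -/
abbrev LocalisingSubcategory (C : Type u) [Category.{v} C] :=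
  {P : ObjectProperty C // IsLocalisingSubcategory P}

/-!
The isomorphism is composed of two, which meet in the Grothendieck topologies on the category
`(SingleObj M)ᵒᵖ`, ordered by reverse inclusion.

*Localising subcategories and topologies.* `M`-sets are presheaves of sets on `(SingleObj M)ᵒᵖ`.
Over any small category, the localising subcategories of presheaves are the categories of sheaves
(`LocalisingSubcategory.orderIsoGrothendieckTopology`). Given such a subcategory `P` with reflector
`ρ`, let `J` be the finest topology for which the members of `P` are sheaves. As `ρ` respects
equalizers and pullbacks, a morphism inverted by `ρ` is locally injective and locally surjective for
`J`. The unit `F ⟶ ρ F` is such a morphism; if `F` is a `J`-sheaf, it is thus a locally bijective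
morphism of sheaves, so an isomorphism, and `F` is in `P`
(`IsLocalisingSubcategory.isSheaf_finestTopology_iff`). Conversely sheafification respects finite
limits, and a topology is determined by its sheaves.

*Topologies and open sets.* A sieve on the object of `(SingleObj M)ᵒᵖ` is an ideal of `M`, so a
topology is a class of covering ideals. To a topology we assign the set of the primes that do not
cover. As `M` is finitely generated modulo units, its ideals satisfy the ascending chain condition by
Dickson's lemma, and an ideal that is maximal among those which do not cover is prime
(`SemigroupIdeal.exists_prime_of_not`); so an ideal covers if and only if it is contained in none of
these primes, and they determine the topology. The sets of primes that arise are those closed under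
passing to smaller primes, and these are the open sets: inverting the finitely many generators of
`M / Mˣ` outside a prime `p` gives a basic open neighbourhood of `p` whose points are the primes
contained in `p` (`MonoidSpec.exists_notMem_forall_le`).
-/

/-! ### Transport of localising subcategories along an equivalence -/

namespace IsLocalisingSubcategory

universe v' u'

variable {C : Type u} [Category.{v} C] {D : Type u'} [Category.{v'} D]

/-- The preimage of a localising subcategory under an equivalence is localising: its reflector is the
given one, conjugated by the equivalence. -/
lemma inverseImage (e : C ≌ D) {Q : ObjectProperty D} (hQ : IsLocalisingSubcategory Q) :
    IsLocalisingSubcategory (Q.inverseImage e.functor) where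
  mem_of_iso i hX := hQ.mem_of_iso (e.functor.mapIso i) hX
  exists_localisation := by
    obtain ⟨ρ, ⟨adj⟩, _⟩ := hQ.exists_localisation
    have : Q.IsClosedUnderIsomorphisms := ⟨fun i hX => hQ.mem_of_iso i hX⟩
    let E := e.congrFullSubcategory (P := Q.inverseImage e.functor) (Q := Q) rfl
    have adj' := (e.toAdjunction.comp adj).comp E.symm.toAdjunction
    refine ⟨_, ⟨adj'.ofNatIsoRight ?_⟩, inferInstance⟩
    exact Functor.isoWhiskerLeft (Q.inverseImage e.functor).ι e.unitIso.symm

end IsLocalisingSubcategory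

/-- Equivalent categories have isomorphic posets of localising subcategories. -/
def CategoryTheory.Equivalence.localisingSubcategoryOrderIso {C : Type u} [Category.{v} C]
    {D : Type*} [Category* D] (e : C ≌ D) :
    LocalisingSubcategory C ≃o LocalisingSubcategory D where
  toFun P := ⟨_, P.2.inverseImage e.symm⟩
  invFun Q := ⟨_, Q.2.inverseImage e⟩
  left_inv P := by
    ext X
    exact ⟨P.2.mem_of_iso (e.unitIso.app X).symm, P.2.mem_of_iso (e.unitIso.app X)⟩
  right_inv Q := by
    ext X
    exact ⟨Q.2.mem_of_iso (e.counitIso.app X), Q.2.mem_of_iso (e.counitIso.app X).symm⟩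
  map_rel_iff' {P Q} :=
    ⟨fun h X hX => Q.2.mem_of_iso (e.unitIso.app X).symm
      (h _ (P.2.mem_of_iso (e.unitIso.app X) hX)), fun h _ hX => h _ hX⟩

/-! ### Localising subcategories of presheaves and Grothendieck topologies -/

section Presheaf

universe w

variable {C : Type w} [Category.{max w v} C]

/-- Sheaves of types form a localising subcategory of presheaves. -/
lemma CategoryTheory.GrothendieckTopology.isLocalisingSubcategory_isSheaf
    (J : GrothendieckTopology C) :
    IsLocalisingSubcategory (fun F : Cᵒᵖ ⥤ Type (max w v) => Presieve.IsSheaf J F) where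
  mem_of_iso i hX := Presieve.isSheaf_iso J i hX
  exists_localisation := by
    have h : (fun F : Cᵒᵖ ⥤ Type (max w v) => Presieve.IsSheaf J F) = Presheaf.IsSheaf J := by
      ext F
      exact (isSheaf_iff_isSheaf_of_type J F).symm
    rw [h]
    exact ⟨presheafToSheaf J _, ⟨sheafificationAdjunction J _⟩,
      inferInstanceAs (PreservesFiniteLimits (presheafToSheaf J _))⟩

/-- If `K ⟶ yoneda X` induces a bijection on maps into `Q`, then `Q` is a sheaf for the sieve
`S` that is its image: existence of extensions from `S` comes from those from `K`, and so does their
uniqueness, as `K` maps onto `S`. -/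
lemma CategoryTheory.Presieve.isSheafFor_of_bijective_comp {X : C} (S : Sieve X)
    {K Q : Cᵒᵖ ⥤ Type (max w v)} (g : K ⟶ yoneda.obj X)
    (hS : ∀ ⦃Y : C⦄ (h : Y ⟶ X), S h ↔ ∃ t : K.obj (.op Y), g.app (.op Y) t = h)
    (hg : Function.Bijective fun φ : yoneda.obj X ⟶ Q => g ≫ φ) :
    Presieve.IsSheafFor Q S.arrows := by
  intro x hx
  rw [Presieve.compatible_iff_sieveCompatible] at hx
  have mem (Y : Cᵒᵖ) (t : K.obj Y) : S (g.app Y t) := (hS _).2 ⟨t, rfl⟩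
  have congr_fam {Y : C} {h h' : Y ⟶ X} (e : h = h') (hh : S h) (hh' : S h') :
      x h hh = x h' hh' := by subst e; rfl
  -- The composite of `K ⟶ S` with the map from `S` to `Q` that the family `x` defines.
  let k : K ⟶ Q :=
    { app := fun Y => ↾ fun t => x (g.app Y t) (mem Y t)
      naturality := by
        intro Y Z f
        ext t
        have h := hx (g.app Y t) f.unop (mem Y t)
        have hn : g.app Z (K.map f t) = f.unop ≫ g.app Y t := NatTrans.naturality_apply g f t
        exact (congr_fam hn (mem _ _) (S.downward_closed (mem Y t) _)).trans h }
  obtain ⟨φ, hφ⟩ := hg.2 k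
  dsimp only at hφ
  have hφ' (Y : Cᵒᵖ) (t : K.obj Y) : φ.app Y (g.app Y t) = x (g.app Y t) (mem Y t) :=
    congr($hφ |>.app Y t)
  refine ⟨yonedaEquiv φ, ?_, ?_⟩
  · intro Y h hh
    obtain ⟨t, rfl⟩ := (hS h).1 hh
    refine Eq.trans ?_ (hφ' (.op Y) t)
    obtain ⟨q, rfl⟩ := yonedaEquiv.symm.surjective φ
    rw [Equiv.apply_symm_apply]
    rfl
  · intro y hy
    rw [← Equiv.symm_apply_eq]
    apply hg.1
    dsimp only
    rw [hφ]
    ext Y t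
    exact hy _ (mem Y t)

variable {P : ObjectProperty (Cᵒᵖ ⥤ Type (max w v))}

/-- The finest topology for which the members of a class `P` of presheaves are sheaves. -/
abbrev CategoryTheory.ObjectProperty.finestTopology (P : ObjectProperty (Cᵒᵖ ⥤ Type (max w v))) :
    GrothendieckTopology C :=
  Sheaf.finestTopology (Set.ofPred P)

namespace IsLocalisingSubcategory

variable {ρ : (Cᵒᵖ ⥤ Type (max w v)) ⥤ P.FullSubcategory}

/-- A morphism inverted by the reflector is orthogonal to the members of the subcategory. -/
lemma isLocal_of_isIso_map (adj : ρ ⊣ P.ι) {F G : Cᵒᵖ ⥤ Type (max w v)} (f : F ⟶ G)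
    [IsIso (ρ.map f)] : P.isLocal f := fun Q hQ =>
  (ObjectProperty.isLocal_iff_isIso_map adj f).2 inferInstance Q ⟨⟨Q, hQ⟩, rfl⟩

variable [PreservesFiniteLimits ρ]

/-- A morphism inverted by a reflector that respects finite limits is locally injective: if `x` and
`y` have the same image, the reflector inverts the inclusion of the sieve on which `x` and `y` agree,
which is an equalizer. -/
lemma isLocallyInjective_finestTopology (adj : ρ ⊣ P.ι) {F G : Cᵒᵖ ⥤ Type (max w v)} (f : F ⟶ G)
    [IsIso (ρ.map f)] : Presheaf.IsLocallyInjective P.finestTopology f where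
  equalizerSieve_mem {X} x y hxy := by
    refine Sheaf.mem_finestTopology_of_forall_isSheafFor fun Q hQ Y p => ?_
    let x' : yoneda.obj Y ⟶ F := yonedaEquiv.symm (F.map p.op x)
    let y' : yoneda.obj Y ⟶ F := yonedaEquiv.symm (F.map p.op y)
    have hxy' : x' ≫ f = y' ≫ f := by
      apply yonedaEquiv.injective
      simp [yonedaEquiv_comp, x', y', NatTrans.naturality_apply, hxy]
    have hρ : ρ.map x' = ρ.map y' := by
      rw [← cancel_mono (ρ.map f), ← ρ.map_comp, hxy', ρ.map_comp]
    have : IsIso (ρ.map (equalizer.ι x' y')) :=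
      isIso_limit_cone_parallelPair_of_eq hρ (isLimitOfHasEqualizerOfPreservesLimit ρ x' y')
    refine Presieve.isSheafFor_of_bijective_comp _ (equalizer.ι x' y') (fun Z h => ?_)
      (isLocal_of_isIso_map adj _ Q hQ)
    constructor
    · intro hh
      have w : yoneda.map h ≫ x' = yoneda.map h ≫ y' := by
        rw [yonedaEquiv_symm_naturality_left, yonedaEquiv_symm_naturality_left]
        simpa using hh
      refine ⟨yonedaEquiv (equalizer.lift _ w), ?_⟩
      rw [← yonedaEquiv_comp, equalizer.lift_ι]
      exact yonedaEquiv_yoneda_map h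
    · rintro ⟨t, rfl⟩
      have := congr($(equalizer.condition x' y').app _ t)
      simpa [x', y'] using this

/-- A morphism inverted by a reflector that respects finite limits is locally surjective: the sieve
of the arrows along which a section lifts is the image of a base change of the morphism, which is
inverted by the reflector again. -/
lemma isLocallySurjective_finestTopology (adj : ρ ⊣ P.ι) {F G : Cᵒᵖ ⥤ Type (max w v)} (f : F ⟶ G)
    [IsIso (ρ.map f)] : Presheaf.IsLocallySurjective P.finestTopology f where
  imageSieve_mem {X} s := by
    refine Sheaf.mem_finestTopology_of_forall_isSheafFor fun Q hQ Y p => ?_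
    let s' : yoneda.obj Y ⟶ G := yonedaEquiv.symm (G.map p.op s)
    have : IsIso (ρ.map (pullback.snd f s')) :=
      ((IsPullback.of_hasPullback f s').map ρ).isIso_snd_of_isIso
    refine Presieve.isSheafFor_of_bijective_comp _ (pullback.snd f s') (fun Z h => ?_)
      (isLocal_of_isIso_map adj _ Q hQ)
    constructor
    · rintro ⟨t, ht⟩
      have w : yonedaEquiv.symm t ≫ f = yoneda.map h ≫ s' := by
        rw [yonedaEquiv_symm_naturality_left]
        refine (yonedaEquiv_symm_naturality_right _ f t).trans (congrArg yonedaEquiv.symm ?_)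
        simpa using ht
      refine ⟨yonedaEquiv (pullback.lift _ _ w), ?_⟩
      rw [← yonedaEquiv_comp, pullback.lift_snd]
      exact yonedaEquiv_yoneda_map h
    · rintro ⟨t, rfl⟩
      have := congr($(pullback.condition (f := f) (g := s')).app _ t)
      refine ⟨(pullback.fst f s').app _ t, ?_⟩
      simpa [s'] using this

/-- A localising subcategory of presheaves is the category of sheaves for the finest topology for
which its members are sheaves: the unit of the adjunction at such a sheaf `F` is a locally bijective
morphism between sheaves, hence an isomorphism, so that `F` is in the subcategory. -/
lemma isSheaf_finestTopology_iff (hP : IsLocalisingSubcategory P) (F : Cᵒᵖ ⥤ Type (max w v)) :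
    Presieve.IsSheaf P.finestTopology F ↔ P F := by
  refine ⟨fun hF => ?_, fun hF => Sheaf.sheaf_for_finestTopology _ hF⟩
  obtain ⟨ρ, ⟨adj⟩, _⟩ := hP.exists_localisation
  have : IsIso (ρ.map (adj.unit.app F)) := inferInstance
  have hW : P.finestTopology.W (adj.unit.app F) :=
    (GrothendieckTopology.W_iff_isLocallyBijective _ _).2
      ⟨isLocallyInjective_finestTopology adj _, isLocallySurjective_finestTopology adj _⟩
  have hρ : Presieve.IsSheaf P.finestTopology (ρ.obj F).obj :=
    Sheaf.sheaf_for_finestTopology _ (ρ.obj F).property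
  have : IsIso (adj.unit.app F) :=
    (ObjectProperty.isLocal_iff_isIso _ _ ((isSheaf_iff_isSheaf_of_type _ _).2 hF)
      ((isSheaf_iff_isSheaf_of_type _ _).2 hρ)).1 hW
  exact hP.mem_of_iso (asIso (adj.unit.app F)).symm (ρ.obj F).property

end IsLocalisingSubcategory

variable (C) in
/-- Localising subcategories of a category of presheaves correspond to Grothendieck topologies,
larger subcategories corresponding to coarser topologies. -/
noncomputable def LocalisingSubcategory.orderIsoGrothendieckTopology :
    LocalisingSubcategory (Cᵒᵖ ⥤ Type (max w v)) ≃o (GrothendieckTopology C)ᵒᵈ where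
  toFun P := .toDual P.1.finestTopology
  invFun J := ⟨_, J.ofDual.isLocalisingSubcategory_isSheaf⟩
  left_inv P := by
    ext F
    exact P.2.isSheaf_finestTopology_iff F
  right_inv J := by
    refine congrArg OrderDual.toDual (topology_eq_iff_same_sheaves.2 fun F => ?_)
    exact J.ofDual.isLocalisingSubcategory_isSheaf.isSheaf_finestTopology_iff F
  map_rel_iff' {P Q} := by
    constructor
    · intro h F hF
      rw [← Q.2.isSheaf_finestTopology_iff]
      exact Presieve.isSheaf_of_le _ h ((P.2.isSheaf_finestTopology_iff F).2 hF)
    · intro h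
      exact Sheaf.le_finestTopology _ _ fun F hF => Sheaf.sheaf_for_finestTopology _ (h F hF)

end Presheaf

/-! ### Prime ideals of monoids that are finitely generated up to units -/

section FinitelyGenerated

variable {M : Type u} [CommMonoid M]

/-- Divisibility is a well-quasi-order on a commutative monoid that is finitely generated up to
units: modulo units the monoid is a quotient of some `ℕ ^ k`, so that **Dickson's lemma** applies.
-/
lemma wellQuasiOrdered_dvd_of_fg_associates (hM : Monoid.FG (Associates M)) :
    WellQuasiOrdered ((· ∣ ·) : M → M → Prop) := by
  obtain ⟨s, hs⟩ := hM.fg_top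
  have hw : WellQuasiOrdered ((· ≤ ·) : Associates M → Associates M → Prop) := by
    refine (wellQuasiOrdered_le (α := s → ℕ)).of_surjective
      (f := ⟨fun e => ∏ i : s, (i : Associates M) ^ e i, fun {a b} h =>
        Finset.prod_dvd_prod_of_dvd _ _ fun i _ => pow_dvd_pow _ (h i)⟩) fun x => ?_
    have hx : x ∈ Submonoid.closure (s : Set (Associates M)) := hs ▸ Submonoid.mem_top x
    obtain ⟨f, -, rfl⟩ := Submonoid.mem_closure_finset.1 hx
    exact ⟨fun i => f i, Finset.prod_coe_sort s fun i => i ^ f i⟩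
  intro a
  obtain ⟨i, j, hij, h⟩ := hw fun n => Associates.mk (a n)
  exact ⟨i, j, hij, Associates.mk_dvd_mk.1 h⟩

/-- The ideals of a commutative monoid that is finitely generated up to units satisfy the ascending
chain condition. -/
lemma SemigroupIdeal.wellFoundedGT_of_fg_associates (hM : Monoid.FG (Associates M)) :
    WellFoundedGT (SemigroupIdeal M) := by
  refine ⟨RelEmbedding.wellFounded_iff_isEmpty.2 ⟨fun f => ?_⟩⟩
  have hf : StrictMono f := fun m n hmn => f.map_rel_iff.2 hmn
  choose a ha ha' using fun n : ℕ => SetLike.exists_of_lt (hf n.lt_succ_self)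
  obtain ⟨i, j, hij, c, hc⟩ := wellQuasiOrdered_dvd_of_fg_associates hM a
  refine ha' j (hf.monotone (Nat.succ_le_of_lt hij) ?_)
  rw [hc, mul_comm]
  exact SemigroupIdeal.mul_mem _ c (ha i)

namespace MonoidSpec

variable (p q : MonoidSpec M)

lemma one_notMem : (1 : M) ∉ p.asIdeal := fun h =>
  p.ne_univ (Set.eq_univ_of_forall fun x => by simpa using p.asIdeal.mul_mem x h)

/-- The complement of a prime ideal, as a submonoid. -/
def primeCompl : Submonoid M where
  carrier := {x | x ∉ p.asIdeal}
  one_mem' := p.one_notMem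
  mul_mem' ha hb hab := (p.mem_or_mem _ _ hab).elim ha hb

variable {p q}

lemma mem_primeCompl_of_dvd {x y : M} (h : x ∣ y) (hy : y ∈ p.primeCompl) :
    x ∈ p.primeCompl := by
  obtain ⟨c, rfl⟩ := h
  exact fun hx => hy (by rw [mul_comm]; exact p.asIdeal.mul_mem c hx)

/-- Every prime `p` has a basic open neighbourhood consisting of the primes contained in `p`: take
for `f` the product of those generators of `M` modulo units that are not in `p`. -/
lemma exists_notMem_forall_le (hM : Monoid.FG (Associates M)) (p : MonoidSpec M) :
    ∃ f ∉ p.asIdeal, ∀ q : MonoidSpec M, f ∉ q.asIdeal → q.asIdeal ≤ p.asIdeal := by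
  classical
  obtain ⟨s, hs⟩ := hM.fg_top
  let t := s.filter fun g => Quot.out g ∈ p.primeCompl
  have ht : ∏ g ∈ t, Quot.out g ∈ p.primeCompl :=
    Submonoid.prod_mem _ fun g hg => (Finset.mem_filter.1 hg).2
  refine ⟨∏ g ∈ t, Quot.out g, ht, fun q hq x => not_imp_not.1 ?_⟩
  suffices ∀ a : Associates M, ∀ x, Associates.mk x = a → x ∈ p.primeCompl → x ∈ q.primeCompl from
    this _ x rfl
  intro a
  have ha : a ∈ Submonoid.closure (s : Set (Associates M)) := hs ▸ Submonoid.mem_top a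
  induction ha using Submonoid.closure_induction with
  | mem g hg =>
    rintro x rfl hx
    have hassoc := Associates.mk_quot_out x
    have hmem : Associates.mk x ∈ t :=
      Finset.mem_filter.2 ⟨hg, mem_primeCompl_of_dvd hassoc.dvd hx⟩
    exact mem_primeCompl_of_dvd (hassoc.dvd'.trans (Finset.dvd_prod_of_mem Quot.out hmem)) hq
  | one =>
    intro x hx _
    exact mem_primeCompl_of_dvd (Associates.mk_dvd_mk.1 (by rw [hx, Associates.mk_one]))
      q.primeCompl.one_mem
  | mul a b _ _ iha ihb =>
    intro x hx hxp
    obtain ⟨y, rfl⟩ := Associates.mk_surjective a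
    obtain ⟨z, rfl⟩ := Associates.mk_surjective b
    rw [Associates.mk_mul_mk, Associates.mk_eq_mk_iff_associated] at hx
    have hy := iha y rfl (mem_primeCompl_of_dvd ((dvd_mul_right y z).trans hx.dvd') hxp)
    have hz := ihb z rfl (mem_primeCompl_of_dvd ((dvd_mul_left z y).trans hx.dvd') hxp)
    exact mem_primeCompl_of_dvd hx.dvd (q.primeCompl.mul_mem hy hz)

lemma isOpen_iff {U : Set (MonoidSpec M)} :
    IsOpen U ↔ ∃ I : SemigroupIdeal M, zeroLocus I = Uᶜ := Iff.rfl

lemma mem_of_le_of_isOpen {U : Set (MonoidSpec M)} (hU : IsOpen U)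
    (h : q.asIdeal ≤ p.asIdeal) (hp : p ∈ U) : q ∈ U := by
  obtain ⟨I, hI⟩ := isOpen_iff.1 hU
  by_contra hq
  have hIq : q ∈ zeroLocus I := hI ▸ hq
  have hIp : p ∈ zeroLocus I := fun x hx => h (hIq hx)
  rw [hI] at hIp
  exact hIp hp

lemma isOpen_setOf_notMem (f : M) : IsOpen {q : MonoidSpec M | f ∉ q.asIdeal} := by
  refine isOpen_iff.2 ⟨SemigroupIdeal.closure {f}, ?_⟩
  ext q
  simp [zeroLocus, SubMulAction.closure_le]

/-- If `M` is finitely generated up to units, every set of primes that is closed under passing to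
smaller primes is open. -/
lemma isOpen_of_isLowerSet (hM : Monoid.FG (Associates M)) {U : Set (MonoidSpec M)}
    (hU : ∀ p ∈ U, ∀ q : MonoidSpec M, q.asIdeal ≤ p.asIdeal → q ∈ U) : IsOpen U := by
  refine isOpen_iff_forall_mem_open.2 fun p hp => ?_
  obtain ⟨f, hf, h⟩ := exists_notMem_forall_le hM p
  exact ⟨_, fun q hq => hU p hp q (h q hq), isOpen_setOf_notMem f, hf⟩

end MonoidSpec

namespace SemigroupIdeal

/-- The quotient `(I : a) = {m | m * a ∈ I}` of an ideal by an element. -/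
def colon (I : SemigroupIdeal M) (a : M) : SemigroupIdeal M where
  carrier := {m | m * a ∈ I}
  smul_mem' c m hm := by
    change c * m * a ∈ I
    rw [mul_assoc]
    exact I.mul_mem c hm

lemma mem_colon {I : SemigroupIdeal M} {a m : M} : m ∈ I.colon a ↔ m * a ∈ I := Iff.rfl

lemma le_colon (I : SemigroupIdeal M) (a : M) : I ≤ I.colon a := fun m hm => by
  rw [mem_colon, mul_comm]
  exact I.mul_mem a hm

lemma colon_eq_top {I : SemigroupIdeal M} {a : M} (ha : a ∈ I) : I.colon a = ⊤ :=
  top_unique fun m _ => I.mul_mem m ha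

/-- Let `F` be a class of ideals that contains `M` and has the local character of the covering
sieves of a Grothendieck topology. If the ideals satisfy the ascending chain condition, then every
ideal outside `F` is contained in a prime outside `F`, since an ideal that is maximal outside `F` is
prime. -/
lemma exists_prime_of_not [WellFoundedGT (SemigroupIdeal M)] {F : SemigroupIdeal M → Prop}
    (top : F ⊤) (local_char : ∀ I J : SemigroupIdeal M, F J → (∀ a ∈ J, F (I.colon a)) → F I)
    {I : SemigroupIdeal M} (hI : ¬ F I) : ∃ p : MonoidSpec M, I ≤ p.asIdeal ∧ ¬ F p.asIdeal := by
  have mono {I J : SemigroupIdeal M} (h : J ≤ I) (hJ : F J) : F I :=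
    local_char I J hJ fun a ha => by rwa [colon_eq_top (h ha)]
  obtain ⟨P, hIP, hP⟩ := exists_maximal_ge_of_wellFoundedGT (fun I => ¬ F I) I hI
  have maximal {J : SemigroupIdeal M} {a : M} (hle : P ≤ J) (ha : a ∈ J) (haP : a ∉ P) : F J := by
    by_contra hJ
    exact haP (hP.2 hJ hle ha)
  refine ⟨⟨P, fun h => hP.1 ?_, fun a b hab => ?_⟩, hIP, hP.1⟩
  · rwa [show P = ⊤ from SetLike.coe_injective h]
  · by_contra! h
    -- `P : b` strictly contains `P`, as it contains `a`; and so does `P : x` for `x` in `P : b`.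
    refine hP.1 (local_char P (P.colon b) (maximal (P.le_colon b) (mem_colon.2 hab) h.1)
      fun x hx => maximal (P.le_colon x) (a := b) ?_ h.2)
    rwa [mem_colon, mul_comm]

end SemigroupIdeal

end FinitelyGenerated

/-! ### Grothendieck topologies on a commutative monoid -/

section Sieves

open Opposite

variable {M : Type u} [CommMonoid M]

namespace SemigroupIdeal

/-- An ideal of `M`, as a sieve on an object of `(SingleObj M)ᵒᵖ` (whose objects are all equal
by definition, and whose morphisms are the elements of `M`). -/
def toSieve (I : SemigroupIdeal M) (X : (SingleObj M)ᵒᵖ) : Sieve X where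
  arrows _ f := (f.unop : M) ∈ I
  downward_closed hf g := I.mul_mem g.unop hf

/-- A sieve on an object of `(SingleObj M)ᵒᵖ`, as an ideal of `M`. The two constructions are inverse
to each other by definition. -/
def ofSieve {X : (SingleObj M)ᵒᵖ} (S : Sieve X) : SemigroupIdeal M where
  carrier := {m : M | S.arrows (Y := op (SingleObj.star M)) (Quiver.Hom.op m)}
  smul_mem' c _ hm := S.downward_closed (Z := op (SingleObj.star M)) hm (Quiver.Hom.op c)

variable {X : (SingleObj M)ᵒᵖ}

lemma ofSieve_pullback {Y : (SingleObj M)ᵒᵖ} (S : Sieve X) (f : Y ⟶ X) :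
    ofSieve (S.pullback f) = (ofSieve S).colon f.unop := rfl

end SemigroupIdeal

open SemigroupIdeal

/-- The Grothendieck topology of a set `U` of primes: a sieve covers if no prime in `U`
contains it. -/
def MonoidSpec.grothendieckTopology (U : Set (MonoidSpec M)) :
    GrothendieckTopology (SingleObj M)ᵒᵖ where
  sieves X := {S | ∀ p ∈ U, ¬ ofSieve S ≤ p.asIdeal}
  top_mem' X p _ h := p.one_notMem (h trivial)
  pullback_stable' X Y S f hS p hp h := by
    rw [ofSieve_pullback] at h
    exact hS p hp ((le_colon _ _).trans h)
  transitive' X S hS R hR p hp h := by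
    obtain ⟨s, hs, hsp⟩ := SetLike.not_le_iff_exists.1 (hS p hp)
    have hR' := hR (Y := op (SingleObj.star M)) (f := Quiver.Hom.op s) hs p hp
    rw [ofSieve_pullback] at hR'
    obtain ⟨t, ht, htp⟩ := SetLike.not_le_iff_exists.1 hR'
    exact (p.mem_or_mem t s (h ht)).elim htp hsp

namespace CategoryTheory.GrothendieckTopology

variable (J : GrothendieckTopology (SingleObj M)ᵒᵖ)

/-- An ideal of `M` is covering for `J` if its sieve is. -/
def IsCovering (I : SemigroupIdeal M) : Prop := I.toSieve (op (SingleObj.star M)) ∈ J _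

variable {J}

lemma isCovering_ofSieve {X : (SingleObj M)ᵒᵖ} {S : Sieve X} :
    J.IsCovering (ofSieve S) ↔ S ∈ J X := Iff.rfl

lemma IsCovering.mono {I I' : SemigroupIdeal M} (h : I ≤ I') (hI : J.IsCovering I) :
    J.IsCovering I' :=
  J.superset_covering (fun _ _ hf => h hf) hI

variable (J)

lemma isCovering_top : J.IsCovering (⊤ : SemigroupIdeal M) := J.top_mem _

/-- The transitivity axiom, in terms of ideals. -/
lemma isCovering_of_colon (I I' : SemigroupIdeal M) (hI' : J.IsCovering I')
    (h : ∀ a ∈ I', J.IsCovering (I.colon a)) : J.IsCovering I := by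
  refine J.transitive hI' _ fun Y f hf => ?_
  have := h f.unop hf
  rw [← isCovering_ofSieve, ofSieve_pullback]
  exact this

/-- A topology is determined by the primes that it does not cover: an ideal is covering if and only
if every prime containing it is covering. -/
lemma isCovering_iff_forall_prime (hM : Monoid.FG (Associates M)) (I : SemigroupIdeal M) :
    J.IsCovering I ↔ ∀ p : MonoidSpec M, ¬ J.IsCovering p.asIdeal → ¬ I ≤ p.asIdeal := by
  refine ⟨fun hI p hp hle => hp (hI.mono hle), fun h => ?_⟩
  have := wellFoundedGT_of_fg_associates hM
  by_contra hI
  obtain ⟨p, hle, hp⟩ := exists_prime_of_not J.isCovering_top J.isCovering_of_colon hI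
  exact h p hp hle

/-- If `M` is finitely generated up to units, Grothendieck topologies on `(SingleObj M)ᵒᵖ`
correspond to open sets of primes, a topology being sent to the set of the primes that are not
covering. -/
def orderIsoOpens (hM : Monoid.FG (Associates M)) :
    (GrothendieckTopology (SingleObj M)ᵒᵖ)ᵒᵈ ≃o TopologicalSpace.Opens (MonoidSpec M) where
  toFun J := ⟨{p | ¬ J.ofDual.IsCovering p.asIdeal},
    MonoidSpec.isOpen_of_isLowerSet hM fun _ hp _ h hq => hp (hq.mono h)⟩
  invFun U := .toDual (MonoidSpec.grothendieckTopology U)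
  left_inv J := congrArg OrderDual.toDual <| GrothendieckTopology.ext <| funext fun _ =>
    Set.ext fun S => (J.ofDual.isCovering_iff_forall_prime hM (ofSieve S)).symm
  right_inv U := by
    ext p
    change ¬ (∀ q ∈ U, ¬ p.asIdeal ≤ q.asIdeal) ↔ p ∈ U
    push Not
    exact ⟨fun ⟨q, hq, h⟩ => MonoidSpec.mem_of_le_of_isOpen U.isOpen h hq,
      fun hp => ⟨p, hp, le_rfl⟩⟩
  map_rel_iff' {J K} := by
    refine ⟨fun h X S hS => ?_, fun h p hp hK => hp (h _ hK)⟩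
    exact (J.ofDual.isCovering_iff_forall_prime hM (ofSieve S)).2 fun p hp =>
      (K.ofDual.isCovering_iff_forall_prime hM (ofSieve S)).1 hS p (h hp)

end CategoryTheory.GrothendieckTopology

end Sieves

/-! ### The isomorphism of posets -/

theorem corollary26 (M : Type u) [CommMonoid M] (hM : Monoid.FG (Associates M)) :
    Nonempty (LocalisingSubcategory (Action (Type u) M) ≃o
      TopologicalSpace.Opens (MonoidSpec M)) := by
  have e : Action (Type u) M ≌ (SingleObj M)ᵒᵖᵒᵖ ⥤ Type u :=
    (Action.functorCategoryEquivalence (Type u) M).trans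
      (opOpEquivalence (SingleObj M)).symm.congrLeft
  exact ⟨e.localisingSubcategoryOrderIso.trans
    ((LocalisingSubcategory.orderIsoGrothendieckTopology _).trans
      (GrothendieckTopology.orderIsoOpens hM))⟩
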